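/- Let $n\ge 3$, let $Z_1,\dots,Z_n,\,Y_1,\dots,Y_{n-3}\in\mathbb R$ (the shear coordinates of the comb-like fat graph of a Riemann sphere with one hole and $n$ orbifold points of order two: $Z_i$ for the pending edges, $Y_j$ for the inner edges), and put $$R=\begin{pmatrix}1&1\\-1&0\end{pmatrix},\quad L=-R^2=\begin{pmatrix}0&1\\-1&-1\end{pmatrix},\quad F=\begin{pmatrix}0&1\\-1&0\end{pmatrix},\quad X_z=\begin{pmatrix}0&-e^{z/2}\\e^{-z/2}&0\end{pmatrix}.$$ Define matrices $\gamma_1,\dots,\gamma_n\in SL_2(\mathbb R)$ by $\gamma_1=F$, $$\gamma_i=-X_{Z_1}\,RX_{Y_1}\,RX_{Y_2}\cdots RX_{Y_{i-2}}\;L\,X_{Z_i}\,F\,X_{Z_i}\,R\;X_{Y_{i-2}}L\cdots X_{Y_2}L\,X_{Y_1}L\;X_{Z_1}\qquad(2\le i\le n-1),$$ $$\gamma_n=-X_{Z_1}\,RX_{Y_1}\,RX_{Y_2}\cdots RX_{Y_{n-3}}\;R\,X_{Z_n}\,F\,X_{Z_n}\,L\;X_{Y_{n-3}}L\cdots X_{Y_2}L\,X_{Y_1}L\;X_{Z_1}.$$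 Let $S$ be the $n\times n$ upper triangular matrix with $1$ on the diagonal and $S_{ij}=-\operatorname{Tr}(\gamma_i\gamma_j)$ for $i<j$, and let $$P=2\sum_{i=1}^nZ_i+2\sum_{j=1}^{n-3}Y_j .$$ Assume $P\neq0$. Then, writing $S^{-T}=(S^T)^{-1}$, the matrix $S^{-T}S$ is similar over $\mathbb R$ to the following Jordan matrix: $$\begin{pmatrix}-e^{P}&0\\0&-e^{-P}\end{pmatrix}\oplus\begin{pmatrix}-1&1\\0&-1\end{pmatrix}\oplus(-\mathbb I_{n-4})\quad\text{if $n$ is even},$$ $$\operatorname{diag}(e^{P},e^{-P},1)\oplus(-\mathbb I_{n-3})\quad\text{if $n$ is odd}.$$ -/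

import Mathlib

open scoped Matrix

noncomputable section

namespace AnCase

/-- The right-turn matrix. -/
def R : Matrix (Fin 2) (Fin 2) ℝ := !![1, 1; -1, 0]

/-- The left-turn matrix, `L = -R²`. -/
def L : Matrix (Fin 2) (Fin 2) ℝ := !![0, 1; -1, -1]

/-- The inversion matrix at a pending vertex. -/
def F : Matrix (Fin 2) (Fin 2) ℝ := !![0, 1; -1, 0]

/-- The edge matrix of an edge with real shear coordinate `z`. -/
def X (z : ℝ) : Matrix (Fin 2) (Fin 2) ℝ :=
  !![0, -Real.exp (z / 2); Real.exp (-(z / 2)), 0]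

/-- The product `R X_{Y_1} R X_{Y_2} ⋯ R X_{Y_k}` (the identity for `k = 0`). -/
def spineOut (Y : ℕ → ℝ) : ℕ → Matrix (Fin 2) (Fin 2) ℝ
  | 0 => 1
  | k + 1 => spineOut Y k * (R * X (Y (k + 1)))

/-- The product `X_{Y_k} L ⋯ X_{Y_2} L X_{Y_1} L` (the identity for `k = 0`). -/
def spineBack (Y : ℕ → ℝ) : ℕ → Matrix (Fin 2) (Fin 2) ℝ
  | 0 => 1
  | k + 1 => (X (Y (k + 1)) * L) * spineBack Y k

/-- The matrices `γ_1, …, γ_n` of the `𝒜_n` case, for `n ≥ 3` and `1 ≤ i ≤ n`. The coordinates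
`Z_1, …, Z_n` (pending edges) and `Y_1, …, Y_{n-3}` (inner edges) are the values of `Z` and `Y` at
these indices; other values of `Z` and `Y` are not used.

* `γ_1 = F`,
* `γ_i = - X_{Z_1} R X_{Y_1} ⋯ R X_{Y_{i-2}} L X_{Z_i} F X_{Z_i} R X_{Y_{i-2}} L ⋯ X_{Y_1} L X_{Z_1}`
  for `2 ≤ i ≤ n - 1`,
* `γ_n = - X_{Z_1} R X_{Y_1} ⋯ R X_{Y_{n-3}} R X_{Z_n} F X_{Z_n} L X_{Y_{n-3}} L ⋯ X_{Y_1} L X_{Z_1}`.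
-/
def gamma (n : ℕ) (Z Y : ℕ → ℝ) (i : ℕ) : Matrix (Fin 2) (Fin 2) ℝ :=
  if i = 1 then F
  else if i < n then
    -(X (Z 1) * spineOut Y (i - 2) * L * X (Z i) * F * X (Z i) * R * spineBack Y (i - 2) * X (Z 1))
  else
    -(X (Z 1) * spineOut Y (n - 3) * R * X (Z n) * F * X (Z n) * L * spineBack Y (n - 3) * X (Z 1))

/-- The upper triangular matrix with `1` on the diagonal and `S_{ij} = -Tr(γ_i γ_j)` for `i < j`.
The element `i : Fin n` stands for the index `i + 1` of `{1, …, n}`. -/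
def stokes (n : ℕ) (Z Y : ℕ → ℝ) : Matrix (Fin n) (Fin n) ℝ :=
  Matrix.of fun i j =>
    if i = j then 1
    else if i < j then -(gamma n Z Y (i + 1) * gamma n Z Y (j + 1)).trace
    else 0

/-- The perimeter `P = 2 ∑_{i=1}^n Z_i + 2 ∑_{j=1}^{n-3} Y_j` of the hole. -/
def perimeter (n : ℕ) (Z Y : ℕ → ℝ) : ℝ :=
  2 * ∑ i ∈ Finset.Icc 1 n, Z i + 2 * ∑ j ∈ Finset.Icc 1 (n - 3), Y j

/-- The `n × n` matrix `diag(-e^P, -e^{-P}) ⊕ [[-1, 1], [0, -1]] ⊕ (-I_{n-4})` (for `n ≥ 4`). -/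
def jordanEven (n : ℕ) (P : ℝ) : Matrix (Fin n) (Fin n) ℝ :=
  Matrix.of fun i j =>
    if i = j then
      if (i : ℕ) = 0 then -Real.exp P
      else if (i : ℕ) = 1 then -Real.exp (-P)
      else -1
    else if (i : ℕ) = 2 ∧ (j : ℕ) = 3 then 1
    else 0

/-- The `n × n` matrix `diag(e^P, e^{-P}, 1) ⊕ (-I_{n-3})` (for `n ≥ 3`). -/
def jordanOdd (n : ℕ) (P : ℝ) : Matrix (Fin n) (Fin n) ℝ :=
  Matrix.diagonal fun i =>
    if (i : ℕ) = 0 then Real.exp P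
    else if (i : ℕ) = 1 then Real.exp (-P)
    else if (i : ℕ) = 2 then 1
    else -1

end AnCase

end

/-!
The matrices `γ_i` are traceless with `γ_i² = -1`: they are half-turns of the hyperbolic plane. On the
three-dimensional space of traceless matrices with the form `-Tr(AB)`, the map `q ↦ γ_i q γ_i` is
the reflection in `γ_i`, and `S + Sᵀ` is the Gram matrix of `γ_1, …, γ_n`. Hence `S^{-T} S` is, up to
sign, the Coxeter element of a reflection group, and its nontrivial part is the product of the `n`
reflections, which is conjugation by the monodromy `γ_1 ⋯ γ_n`, again up to sign.

Concretely, let `comb x = ∑ x_j γ_j`, and let `reflCoeff q` be the vector of the coefficients `x_j` by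
which the successive reflections change `q`. Solving the triangular system with matrix `Sᵀ` amounts
to applying the reflections one by one (`halfGram_transpose_mulVec`), and this gives
`S^{-T} S x = reflCoeff (comb x) - x` (`inv_mul_halfGram_mulVec`). The kernel of `comb` therefore
consists of eigenvectors for `-1`. If conjugation by the monodromy has an eigenvector `q` with
eigenvalue `ν`, then `comb (reflCoeff q) = (1 - (-1)^n ν) q`, so `reflCoeff q` is an eigenvector of
`S^{-T} S` with eigenvalue `-(-1)^n ν`.

After conjugation by `L X_{Z_1}` the monodromy telescopes to a lower triangular matrix with diagonal
`± (e^{-P/2}, e^{P/2})` (`isLower_prodUpTo`), so `ν` runs through `e^P`, `e^{-P}` and `1`. For odd `n`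
none of the factors `1 + ν` vanishes, so these three eigenvectors together with the kernel of `comb`
diagonalize the matrix. For even `n` the eigenvector `reflCoeff q` for `ν = 1` lies in the kernel of
`comb`; as `γ_1, γ_2, γ_3` span the traceless matrices (`trace_gammaConj_ne_zero`), there is `w` with
`comb w = q`, and `S^{-T} S w = reflCoeff q - w` is the Jordan block of size two.
-/

namespace AnCase

/-! ### Traceless square roots of `-1` and reflections -/

lemma trace_two (A : Matrix (Fin 2) (Fin 2) ℝ) : A.trace = A 0 0 + A 1 1 :=
  Matrix.trace_fin_two A

/-- On traceless matrices, `q ↦ g q g` is the reflection in `g` for the form `-Tr(AB)`. -/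
lemma conj_eq_sub_smul {g q : Matrix (Fin 2) (Fin 2) ℝ} (hg : g.trace = 0) (hg2 : g * g = -1)
    (hq : q.trace = 0) : g * q * g = q - (-(g * q).trace) • g := by
  have h00 := congrFun (congrFun hg2 0) 0
  rw [trace_two] at hg hq
  have e1 : g 1 1 = -g 0 0 := by linarith
  have e2 : q 1 1 = -q 0 0 := by linarith
  simp only [Matrix.mul_apply, Fin.sum_univ_two, Matrix.neg_apply, Matrix.one_apply_eq] at h00
  ext i j
  fin_cases i <;> fin_cases j <;>
    simp [Matrix.mul_apply, Fin.sum_univ_two, trace_two, e1, e2] <;>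
    first
    | linear_combination (-q 0 0) * h00
    | linear_combination (-q 0 1) * h00
    | linear_combination (-q 1 0) * h00
    | linear_combination (q 0 0) * h00

/-- The successive images of `q` under `q ↦ g_j q g_j`, which on traceless matrices are the
reflections in `g_0, g_1, …`. -/
def reflOrbit (g : ℕ → Matrix (Fin 2) (Fin 2) ℝ) (q : Matrix (Fin 2) (Fin 2) ℝ) :
    ℕ → Matrix (Fin 2) (Fin 2) ℝ
  | 0 => q
  | j + 1 => g j * reflOrbit g q j * g j

/-- The ordered product `g_0 g_1 ⋯ g_{k-1}`. -/
def prodUpTo (g : ℕ → Matrix (Fin 2) (Fin 2) ℝ) : ℕ → Matrix (Fin 2) (Fin 2) ℝ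
  | 0 => 1
  | k + 1 => prodUpTo g k * g k

/-- The coefficients `x_j = -Tr(g_j q_j)` by which the reflections change `q`:
`q_{j+1} = q_j - x_j g_j`. -/
def reflCoeff (g : ℕ → Matrix (Fin 2) (Fin 2) ℝ) (q : Matrix (Fin 2) (Fin 2) ℝ) (j : ℕ) : ℝ :=
  -(g j * reflOrbit g q j).trace

/-- The map `x ↦ ∑ x_j g_j` from coefficient vectors to matrices. -/
def comb (n : ℕ) (g : ℕ → Matrix (Fin 2) (Fin 2) ℝ) :
    (Fin n → ℝ) →ₗ[ℝ] Matrix (Fin 2) (Fin 2) ℝ :=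
  Fintype.linearCombination ℝ (fun j : Fin n => g j)

/-- The upper triangular half of the Gram matrix of `g_0, …, g_{n-1}` for the form `-Tr(AB)`. -/
def halfGram (n : ℕ) (g : ℕ → Matrix (Fin 2) (Fin 2) ℝ) : Matrix (Fin n) (Fin n) ℝ :=
  Matrix.of fun i j => if i = j then 1 else if i < j then -(g i * g j).trace else 0

variable {g : ℕ → Matrix (Fin 2) (Fin 2) ℝ}

lemma comb_apply {n : ℕ} (x : Fin n → ℝ) : comb n g x = ∑ j, x j • g j := rfl

lemma comb_trace (hg : ∀ i, (g i).trace = 0) {n : ℕ} (x : Fin n → ℝ) :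
    (comb n g x).trace = 0 := by
  simp [comb_apply, Matrix.trace_sum, Matrix.trace_smul, hg]

lemma reflOrbit_trace (hg : ∀ i, (g i).trace = 0) (hg2 : ∀ i, g i * g i = -1)
    {q : Matrix (Fin 2) (Fin 2) ℝ} (hq : q.trace = 0) (k : ℕ) : (reflOrbit g q k).trace = 0 := by
  induction k with
  | zero => exact hq
  | succ k ih =>
    rw [reflOrbit, conj_eq_sub_smul (hg k) (hg2 k) ih, Matrix.trace_sub, Matrix.trace_smul, ih,
      hg k]
    simp

lemma reflOrbit_eq_sub_sum (hg : ∀ i, (g i).trace = 0) (hg2 : ∀ i, g i * g i = -1)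
    {q : Matrix (Fin 2) (Fin 2) ℝ} (hq : q.trace = 0) (k : ℕ) :
    reflOrbit g q k = q - ∑ i ∈ Finset.range k, reflCoeff g q i • g i := by
  induction k with
  | zero => simp [reflOrbit]
  | succ k ih =>
    rw [reflOrbit, conj_eq_sub_smul (hg k) (hg2 k) (reflOrbit_trace hg hg2 hq k),
      Finset.sum_range_succ, ← sub_sub, ← ih]
    rfl

lemma comb_reflCoeff (hg : ∀ i, (g i).trace = 0) (hg2 : ∀ i, g i * g i = -1)
    {q : Matrix (Fin 2) (Fin 2) ℝ} (hq : q.trace = 0) (n : ℕ) :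
    comb n g (fun j => reflCoeff g q j) = q - reflOrbit g q n := by
  rw [reflOrbit_eq_sub_sum hg hg2 hq n, comb_apply,
    Fin.sum_univ_eq_sum_range (fun j => reflCoeff g q j • g j) n]
  abel

lemma prodUpTo_mul_reflOrbit (hg2 : ∀ i, g i * g i = -1) (q : Matrix (Fin 2) (Fin 2) ℝ) (k : ℕ) :
    prodUpTo g k * reflOrbit g q k = (-1 : ℝ) ^ k • (q * prodUpTo g k) := by
  induction k with
  | zero => simp [prodUpTo, reflOrbit]
  | succ k ih =>
    calc prodUpTo g k * g k * (g k * reflOrbit g q k * g k)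
        = prodUpTo g k * (g k * g k) * reflOrbit g q k * g k := by simp only [mul_assoc]
      _ = -(prodUpTo g k * reflOrbit g q k) * g k := by rw [hg2]; simp
      _ = (-1 : ℝ) ^ (k + 1) • (q * (prodUpTo g k * g k)) := by
        rw [ih, pow_succ, ← mul_assoc q]; simp

lemma prodUpTo_isUnit (hg2 : ∀ i, g i * g i = -1) (k : ℕ) : IsUnit (prodUpTo g k) := by
  induction k with
  | zero => exact isUnit_one
  | succ k ih =>
    refine ih.mul (IsUnit.of_mul_eq_one (-g k) ?_)
    rw [mul_neg, hg2, neg_neg]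

/-- If `q` is an eigenvector of conjugation by the product of all `g_j`, then the composition of the
reflections multiplies `q` by the eigenvalue, up to the sign `(-1)^n`. -/
lemma reflOrbit_eq_smul (hg2 : ∀ i, g i * g i = -1) {q : Matrix (Fin 2) (Fin 2) ℝ} {n : ℕ} {ν : ℝ}
    (h : q * prodUpTo g n = ν • (prodUpTo g n * q)) :
    reflOrbit g q n = ((-1) ^ n * ν) • q := by
  apply (prodUpTo_isUnit hg2 n).mul_left_cancel
  rw [prodUpTo_mul_reflOrbit hg2, h, smul_smul, mul_smul_comm]

/-! ### The matrix `S^{-T} S` in terms of reflections -/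

/-- Forward substitution for the lower triangular system with matrix `S^T` is the process of
applying the reflections one after the other. -/
lemma halfGram_transpose_mulVec (hg : ∀ i, (g i).trace = 0) (hg2 : ∀ i, g i * g i = -1)
    {q : Matrix (Fin 2) (Fin 2) ℝ} (hq : q.trace = 0) (n : ℕ) :
    (halfGram n g)ᵀ *ᵥ (fun j : Fin n => reflCoeff g q j) =
      fun j : Fin n => -(g j * q).trace := by
  ext j
  have hq' : q = reflOrbit g q j + ∑ i ∈ Finset.range j, reflCoeff g q i • g i := by
    rw [reflOrbit_eq_sub_sum hg hg2 hq j]; abel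
  have h1 : ∀ i : Fin n, (halfGram n g)ᵀ j i * reflCoeff g q i =
      (fun i : ℕ => (if i = j then reflCoeff g q i else 0) +
        if i < j then -(g j * reflCoeff g q i • g i).trace else 0) i := by
    intro i
    simp only [Matrix.transpose_apply, halfGram, Matrix.of_apply, Fin.ext_iff, Fin.lt_def]
    rcases lt_trichotomy (i : ℕ) j with h | h | h
    · simp [h, h.ne, Matrix.trace_mul_comm (g i), mul_comm]
    · simp [h]
    · simp [h.ne', h.not_gt]
  rw [Matrix.mulVec, dotProduct, Finset.sum_congr rfl fun i _ => h1 i,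
    Fin.sum_univ_eq_sum_range (fun i : ℕ => (if i = j then reflCoeff g q i else 0) +
        if i < j then -(g j * reflCoeff g q i • g i).trace else 0) n,
    Finset.sum_add_distrib, Finset.sum_ite_eq', if_pos (Finset.mem_range.2 j.2),
    ← Finset.sum_filter]
  have h2 : (Finset.range n).filter (· < (j : ℕ)) = Finset.range j := by
    ext i; simp only [Finset.mem_filter, Finset.mem_range]; have := j.2; omega
  rw [h2]
  conv_rhs => rw [hq', mul_add, Matrix.trace_add, Finset.mul_sum, Matrix.trace_sum]
  rw [Finset.sum_neg_distrib, reflCoeff]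
  ring

lemma halfGram_add_transpose_mulVec (hg2 : ∀ i, g i * g i = -1) {n : ℕ} (x : Fin n → ℝ) :
    (halfGram n g + (halfGram n g)ᵀ) *ᵥ x = fun j : Fin n => -(g j * comb n g x).trace := by
  ext j
  rw [comb_apply, Finset.mul_sum, Matrix.trace_sum, ← Finset.sum_neg_distrib, Matrix.mulVec,
    dotProduct]
  refine Finset.sum_congr rfl fun i _ => ?_
  simp only [Matrix.add_apply, Matrix.transpose_apply, halfGram, Matrix.of_apply]
  rcases lt_trichotomy i j with h | h | h
  · simp [h.ne, h.ne', h, h.not_gt, Matrix.trace_mul_comm (g i), mul_comm]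
  · subst h; simp [hg2]; ring
  · simp [h.ne, h.ne', h, h.not_gt, mul_comm]

lemma halfGram_transpose_det (n : ℕ) : (halfGram n g)ᵀ.det = 1 := by
  rw [Matrix.det_transpose, Matrix.det_of_isUpperTriangular]
  · simp [halfGram]
  · intro i j (h : j < i)
    simp [halfGram, h.ne', h.not_gt]

/-- Modulo the identity, `S^{-T} S` factors through the space of traceless matrices. -/
lemma inv_mul_halfGram_mulVec (hg : ∀ i, (g i).trace = 0) (hg2 : ∀ i, g i * g i = -1)
    {n : ℕ} (x : Fin n → ℝ) :
    (((halfGram n g)ᵀ)⁻¹ * halfGram n g) *ᵥ x =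
      (fun j : Fin n => reflCoeff g (comb n g x) j) - x := by
  have hu : IsUnit ((halfGram n g)ᵀ).det := by rw [halfGram_transpose_det]; exact isUnit_one
  have h1 : halfGram n g *ᵥ x =
      (halfGram n g)ᵀ *ᵥ ((fun j : Fin n => reflCoeff g (comb n g x) j) - x) := by
    rw [Matrix.mulVec_sub, halfGram_transpose_mulVec hg hg2 (comb_trace hg x),
      ← halfGram_add_transpose_mulVec hg2, Matrix.add_mulVec]
    abel
  rw [← Matrix.mulVec_mulVec, h1, Matrix.mulVec_mulVec, Matrix.nonsing_inv_mul _ hu,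
    Matrix.one_mulVec]

lemma reflOrbit_smul (c : ℝ) (q : Matrix (Fin 2) (Fin 2) ℝ) (k : ℕ) :
    reflOrbit g (c • q) k = c • reflOrbit g q k := by
  induction k with
  | zero => rfl
  | succ k ih => simp [reflOrbit, ih]

lemma reflCoeff_smul (c : ℝ) (q : Matrix (Fin 2) (Fin 2) ℝ) (k : ℕ) :
    reflCoeff g (c • q) k = c * reflCoeff g q k := by
  simp [reflCoeff, reflOrbit_smul]

lemma reflCoeff_zero (k : ℕ) : reflCoeff g 0 k = 0 := by
  simpa using reflCoeff_smul (g := g) 0 0 k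

/-- Cramer's rule in the three-dimensional space of traceless matrices, whose volume form is
`Tr(ABC)`. -/
lemma trace_smul_eq {A B C q : Matrix (Fin 2) (Fin 2) ℝ} (hA : A.trace = 0) (hB : B.trace = 0)
    (hC : C.trace = 0) (hq : q.trace = 0) :
    (A * B * C).trace • q =
      (q * B * C).trace • A + (A * q * C).trace • B + (A * B * q).trace • C := by
  rw [trace_two] at hA hB hC hq
  have eA : A 1 1 = -A 0 0 := by linarith
  have eB : B 1 1 = -B 0 0 := by linarith
  have eC : C 1 1 = -C 0 0 := by linarith
  have eq : q 1 1 = -q 0 0 := by linarith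
  ext i j
  fin_cases i <;> fin_cases j <;>
    simp [Matrix.mul_apply, Fin.sum_univ_two, trace_two, eA, eB, eC, eq] <;> ring

lemma exists_comb_eq (hg : ∀ i, (g i).trace = 0) {n : ℕ} (hn : 3 ≤ n)
    (h : (g 0 * g 1 * g 2).trace ≠ 0) {q : Matrix (Fin 2) (Fin 2) ℝ} (hq : q.trace = 0) :
    ∃ w : Fin n → ℝ, comb n g w = q := by
  refine ⟨(g 0 * g 1 * g 2).trace⁻¹ • (Pi.single ⟨0, by omega⟩ (q * g 1 * g 2).trace +
    Pi.single ⟨1, by omega⟩ (g 0 * q * g 2).trace +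
    Pi.single ⟨2, by omega⟩ (g 0 * g 1 * q).trace), ?_⟩
  rw [map_smul, inv_smul_eq_iff₀ h, map_add, map_add]
  simp only [comb, Fintype.linearCombination_apply_single]
  exact (trace_smul_eq (hg 0) (hg 1) (hg 2) hq).symm

/-! ### Bases adapted to a linear map -/

/-- Vectors whose images under `Φ : ℝⁿ → ℝᵏ` form a basis can be completed by vectors of the kernel
of `Φ` to a basis of `ℝⁿ`. -/
lemma exists_isUnit_det_of_linearIndependent {k n : ℕ} (h : k ≤ n)
    (Φ : (Fin n → ℝ) →ₗ[ℝ] (Fin k → ℝ)) (a : Fin k → Fin n → ℝ)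
    (ha : LinearIndependent ℝ (fun i => Φ (a i))) :
    ∃ U : Matrix (Fin n) (Fin n) ℝ, IsUnit U.det ∧
      (∀ i : Fin k, U.col (Fin.castLE h i) = a i) ∧
      ∀ j : Fin n, k ≤ j → Φ (U.col j) = 0 := by
  obtain ⟨m, rfl⟩ := Nat.exists_eq_add_of_le h
  have hdim : m ≤ Module.finrank ℝ (LinearMap.ker Φ) := by
    have h1 := LinearMap.finrank_range_add_finrank_ker Φ
    have h2 := Submodule.finrank_le (LinearMap.range Φ)
    simp only [Module.finrank_fin_fun] at h1 h2
    omega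
  obtain ⟨b, hb⟩ := exists_linearIndependent_of_le_finrank hdim
  have hli : LinearIndependent ℝ (Fin.append a (fun i => (b i : Fin (k + m) → ℝ))) := by
    rw [Fintype.linearIndependent_iff]
    intro c hc
    rw [Fin.sum_univ_add] at hc
    simp only [Fin.append_left, Fin.append_right] at hc
    have hc1 : ∀ i, c (Fin.castAdd m i) = 0 := by
      have := congrArg Φ hc
      simp only [map_add, map_sum, map_smul, map_zero, LinearMap.map_coe_ker, smul_zero,
        Finset.sum_const_zero, add_zero] at this
      exact Fintype.linearIndependent_iff.1 ha _ this
    have hc2 : ∀ i, c (Fin.natAdd k i) = 0 := by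
      simp only [hc1, zero_smul, Finset.sum_const_zero, zero_add] at hc
      refine Fintype.linearIndependent_iff.1 hb _ (Subtype.ext ?_)
      simpa using hc
    exact fun i => Fin.addCases hc1 hc2 i
  refine ⟨(Matrix.of (Fin.append a (fun i => (b i : Fin (k + m) → ℝ))))ᵀ, ?_, ?_, ?_⟩
  · rw [Matrix.det_transpose, ← Matrix.isUnit_iff_isUnit_det]
    exact Matrix.linearIndependent_rows_iff_isUnit.1 hli
  · intro i
    ext r
    exact congrFun (Fin.append_left a (fun i => (b i : Fin (k + m) → ℝ)) i) r
  · intro j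
    refine Fin.addCases (fun i hi => ?_) (fun i _ => ?_) j
    · have := i.2
      simp at hi
      omega
    · have : (Matrix.of (Fin.append a (fun i => (b i : Fin (k + m) → ℝ))))ᵀ.col (Fin.natAdd k i) =
          b i := by
        ext r
        exact congrFun (Fin.append_right a (fun i => (b i : Fin (k + m) → ℝ)) i) r
      rw [this]
      exact (b i).2

/-! ### The matrices `γ_i` up to simultaneous conjugation -/

lemma L_mul_R : L * R = -1 := by
  ext i j; fin_cases i <;> fin_cases j <;> simp [L, R, Matrix.mul_apply]

lemma R_mul_L : R * L = -1 := by
  ext i j; fin_cases i <;> fin_cases j <;> simp [L, R, Matrix.mul_apply]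

/-- For the given matrices `L` is `R²`. The sign of `L` is immaterial: replacing `L` by `-L` changes
the `γ_i` by signs, and hence `S` by conjugation with a diagonal matrix of signs. -/
lemma R_mul_R : R * R = L := by
  ext i j; fin_cases i <;> fin_cases j <;> simp [L, R, Matrix.mul_apply]

lemma X_mul_X (z : ℝ) : X z * X z = -1 := by
  ext i j
  fin_cases i <;> fin_cases j <;> simp [X, Matrix.mul_apply, ← Real.exp_add]

lemma X_mul_F_mul_X (z : ℝ) : X z * F * X z = X (2 * z) := by
  ext i j
  fin_cases i <;> fin_cases j <;> (simp [X, F, ← Real.exp_add]; try ring)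

lemma X_trace (z : ℝ) : (X z).trace = 0 := by simp [X]

/-- The way back along the spine undoes the way out, which makes the product of the `γ_i`
telescope. -/
lemma spineBack_mul_spineOut (Y : ℕ → ℝ) (k : ℕ) : spineBack Y k * spineOut Y k = 1 := by
  induction k with
  | zero => simp [spineBack, spineOut]
  | succ k ih =>
    calc X (Y (k + 1)) * L * spineBack Y k * (spineOut Y k * (R * X (Y (k + 1))))
        = X (Y (k + 1)) * L * (spineBack Y k * spineOut Y k) * (R * X (Y (k + 1))) := by
          simp only [mul_assoc]
      _ = X (Y (k + 1)) * (L * R) * X (Y (k + 1)) := by rw [ih, mul_one]; simp only [mul_assoc]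
      _ = 1 := by rw [L_mul_R]; simp [X_mul_X]

/-- The conjugate of `γ_{i+1}` by `L X_{Z_1}`, whose inverse is `X_{Z_1} R`. -/
noncomputable def gammaConj (n : ℕ) (Z Y : ℕ → ℝ) (i : ℕ) : Matrix (Fin 2) (Fin 2) ℝ :=
  (L * X (Z 1)) * gamma n Z Y (i + 1) * (X (Z 1) * R)

lemma conj_left_inv (z : ℝ) : X z * R * (L * X z) = 1 := by
  calc X z * R * (L * X z) = X z * (R * L) * X z := by simp only [mul_assoc]
    _ = 1 := by rw [R_mul_L]; simp [X_mul_X]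

lemma gammaConj_mul (n : ℕ) (Z Y : ℕ → ℝ) (i j : ℕ) :
    gammaConj n Z Y i * gammaConj n Z Y j =
      (L * X (Z 1)) * (gamma n Z Y (i + 1) * gamma n Z Y (j + 1)) * (X (Z 1) * R) := by
  calc _ = (L * X (Z 1)) * gamma n Z Y (i + 1) * (X (Z 1) * R * (L * X (Z 1))) *
        gamma n Z Y (j + 1) * (X (Z 1) * R) := by
          simp only [gammaConj, mul_assoc]
    _ = _ := by rw [conj_left_inv, mul_one]; simp only [mul_assoc]

lemma stokes_eq_halfGram (n : ℕ) (Z Y : ℕ → ℝ) : stokes n Z Y = halfGram n (gammaConj n Z Y) := by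
  ext i j
  have h : (gammaConj n Z Y i * gammaConj n Z Y j).trace =
      (gamma n Z Y (i + 1) * gamma n Z Y (j + 1)).trace := by
    rw [gammaConj_mul, Matrix.trace_mul_comm, ← mul_assoc, conj_left_inv, one_mul]
  simp only [stokes, halfGram, Matrix.of_apply, h]

lemma gammaConj_zero (n : ℕ) (Z Y : ℕ → ℝ) : gammaConj n Z Y 0 = L * X (2 * Z 1) * R := by
  rw [← X_mul_F_mul_X]
  simp [gammaConj, gamma, mul_assoc]

lemma conj_neg_mul (z : ℝ) (A : Matrix (Fin 2) (Fin 2) ℝ) :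
    L * X z * -(X z * A * X z) * (X z * R) = -(L * A * R) := by
  calc _ = -(L * (X z * X z) * A * (X z * X z) * R) := by
        simp only [mul_assoc, neg_mul, mul_neg]
    _ = _ := by rw [X_mul_X]; simp [mul_assoc]

lemma gammaConj_of_lt {n : ℕ} (Z Y : ℕ → ℝ) {i : ℕ} (h0 : 0 < i) (hi : i + 1 < n) :
    gammaConj n Z Y i =
      -(L * spineOut Y (i - 1) * L * X (2 * Z (i + 1)) * (R * spineBack Y (i - 1) * R)) := by
  have h2 : i + 1 - 2 = i - 1 := by omega
  rw [gammaConj, gamma, if_neg (by omega), if_pos hi, h2]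
  have := conj_neg_mul (Z 1) (spineOut Y (i - 1) * L * X (Z (i + 1)) * F * X (Z (i + 1)) * R *
    spineBack Y (i - 1))
  rw [← X_mul_F_mul_X]
  simp only [mul_assoc] at this ⊢
  exact this

lemma gammaConj_of_le {n : ℕ} (hn : 3 ≤ n) (Z Y : ℕ → ℝ) {i : ℕ} (hi : n ≤ i + 1) :
    gammaConj n Z Y i =
      -(L * spineOut Y (n - 3) * R * X (2 * Z n) * (L * spineBack Y (n - 3) * R)) := by
  rw [gammaConj, gamma, if_neg (by omega), if_neg (by omega)]
  have := conj_neg_mul (Z 1) (spineOut Y (n - 3) * R * X (Z n) * F * X (Z n) * L *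
    spineBack Y (n - 3))
  rw [← X_mul_F_mul_X]
  simp only [mul_assoc] at this ⊢
  exact this

/-- Every `γ_i` is conjugate to some `X_z`, up to sign. -/
lemma gammaConj_eq_conj_X {n : ℕ} (hn : 3 ≤ n) (Z Y : ℕ → ℝ) (i : ℕ) :
    ∃ A B : Matrix (Fin 2) (Fin 2) ℝ, ∃ z : ℝ, B * A = -1 ∧ gammaConj n Z Y i = A * X z * B := by
  rcases Nat.eq_zero_or_pos i with rfl | h0
  · exact ⟨L, R, 2 * Z 1, R_mul_L, gammaConj_zero n Z Y⟩
  · rcases lt_or_ge (i + 1) n with hi | hi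
    · refine ⟨-(L * spineOut Y (i - 1) * L), R * spineBack Y (i - 1) * R, 2 * Z (i + 1), ?_, ?_⟩
      · calc _ = -(R * (spineBack Y (i - 1) * (R * L) * spineOut Y (i - 1)) * L) := by
              simp only [mul_assoc, mul_neg]
          _ = _ := by rw [R_mul_L]; simp [spineBack_mul_spineOut, R_mul_L]
      · rw [gammaConj_of_lt Z Y h0 hi]; simp only [mul_assoc, neg_mul]
    · refine ⟨-(L * spineOut Y (n - 3) * R), L * spineBack Y (n - 3) * R, 2 * Z n, ?_, ?_⟩
      · calc _ = -(L * (spineBack Y (n - 3) * (R * L) * spineOut Y (n - 3)) * R) := by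
              simp only [mul_assoc, mul_neg]
          _ = _ := by rw [R_mul_L]; simp [spineBack_mul_spineOut, L_mul_R]
      · rw [gammaConj_of_le hn Z Y hi]; simp only [mul_assoc, neg_mul]

lemma gammaConj_trace {n : ℕ} (hn : 3 ≤ n) (Z Y : ℕ → ℝ) (i : ℕ) :
    (gammaConj n Z Y i).trace = 0 := by
  obtain ⟨A, B, z, h, h'⟩ := gammaConj_eq_conj_X hn Z Y i
  rw [h', Matrix.trace_mul_comm, ← mul_assoc, h]
  simp [X_trace]

lemma gammaConj_sq {n : ℕ} (hn : 3 ≤ n) (Z Y : ℕ → ℝ) (i : ℕ) :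
    gammaConj n Z Y i * gammaConj n Z Y i = -1 := by
  obtain ⟨A, B, z, h, h'⟩ := gammaConj_eq_conj_X hn Z Y i
  have hAB : A * B = -1 := by
    have h1 : -B * A = 1 := by rw [neg_mul, h, neg_neg]
    have h2 := mul_eq_one_comm.1 h1
    rw [← h2, mul_neg, neg_neg]
  calc _ = A * X z * (B * A) * X z * B := by rw [h']; simp only [mul_assoc]
    _ = -(A * (X z * X z) * B) := by rw [h]; simp [mul_assoc]
    _ = -1 := by rw [X_mul_X]; simp [hAB]

/-! ### The monodromy around the hole -/

/-- `A` is lower triangular of determinant `1`, with diagonal `± (e^{-s/2}, e^{s/2})`. -/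
structure IsLower (A : Matrix (Fin 2) (Fin 2) ℝ) (s : ℝ) : Prop where
  upper : A 0 1 = 0
  det : A 0 0 * A 1 1 = 1
  sq : A 0 0 ^ 2 = Real.exp (-s)

lemma IsLower.mul {A B : Matrix (Fin 2) (Fin 2) ℝ} {s t : ℝ} (hA : IsLower A s)
    (hB : IsLower B t) : IsLower (A * B) (s + t) := by
  obtain ⟨a1, a2, a3⟩ := hA
  obtain ⟨b1, b2, b3⟩ := hB
  refine ⟨?_, ?_, ?_⟩
  · simp [Matrix.mul_apply, a1, b1]
  · simp only [Matrix.mul_apply, Fin.sum_univ_two, a1, b1]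
    linear_combination (B 0 0 * B 1 1) * a2 + b2
  · simp only [Matrix.mul_apply, Fin.sum_univ_two, a1]
    rw [neg_add, Real.exp_add, ← a3, ← b3]
    ring

lemma isLower_neg_one : IsLower (-1) 0 := ⟨by simp, by simp, by simp⟩

lemma isLower_L_mul_X (z : ℝ) : IsLower (L * X z) z := by
  refine ⟨?_, ?_, ?_⟩
  · simp [L, X]
  · simp [L, X, ← Real.exp_add]
  · simp only [L, X, Matrix.mul_apply, Fin.sum_univ_two]
    simp only [Matrix.of_apply, Matrix.cons_val', Matrix.cons_val_zero, Matrix.cons_val_one,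
      Matrix.cons_val_fin_one, zero_mul, one_mul, zero_add]
    rw [sq, ← Real.exp_add]
    congr 1
    ring

lemma isLower_spineBack (Y : ℕ → ℝ) (k : ℕ) :
    IsLower (L * spineBack Y k * R) (∑ j ∈ Finset.Icc 1 k, Y j) := by
  induction k with
  | zero => simpa [spineBack, L_mul_R] using isLower_neg_one
  | succ k ih =>
    have h : L * spineBack Y (k + 1) * R = L * X (Y (k + 1)) * (L * spineBack Y k * R) := by
      simp only [spineBack, mul_assoc]
    rw [h, Finset.sum_Icc_succ_top (by omega), add_comm (Finset.sum _ _)]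
    exact (isLower_L_mul_X _).mul ih

/-- The first `k + 2 < n` factors multiply to a lower triangular matrix followed by the way back
along the spine. -/
lemma exists_prodUpTo_gammaConj {n : ℕ} (Z Y : ℕ → ℝ) (k : ℕ) (hk : k + 2 < n) :
    ∃ T, IsLower T (2 * ∑ i ∈ Finset.Icc 1 (k + 2), Z i + ∑ j ∈ Finset.Icc 1 k, Y j) ∧
      prodUpTo (gammaConj n Z Y) (k + 2) = T * (R * spineBack Y k * R) := by
  induction k with
  | zero =>
    refine ⟨L * X (2 * Z 1) * (L * X (2 * Z 2)), ?_, ?_⟩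
    · convert (isLower_L_mul_X (2 * Z 1)).mul (isLower_L_mul_X (2 * Z 2)) using 1
      simp [Finset.sum_Icc_succ_top]
      ring
    · calc 1 * gammaConj n Z Y 0 * gammaConj n Z Y 1
          = -(L * X (2 * Z 1) * (R * L) * L * X (2 * Z 2) * R * R) := by
            rw [gammaConj_zero, gammaConj_of_lt Z Y one_pos (by omega)]
            simp [spineOut, spineBack, mul_assoc]
        _ = _ := by rw [R_mul_L]; simp [spineBack, mul_assoc]
  | succ k ih =>
    obtain ⟨T, hT, hprod⟩ := ih (by omega)
    refine ⟨T * (L * X (Y (k + 1))) * (L * X (2 * Z (k + 3))), ?_, ?_⟩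
    · convert (hT.mul (isLower_L_mul_X (Y (k + 1)))).mul
        (isLower_L_mul_X (2 * Z (k + 3))) using 1
      rw [Finset.sum_Icc_succ_top (by omega), Finset.sum_Icc_succ_top (b := k) (by omega)]
      ring
    · rw [prodUpTo, hprod, gammaConj_of_lt Z Y (by omega) (by omega)]
      have e1 : k + 2 - 1 = k + 1 := by omega
      rw [e1]
      calc T * (R * spineBack Y k * R) * -(L * spineOut Y (k + 1) * L * X (2 * Z (k + 3)) *
            (R * spineBack Y (k + 1) * R))
          = -(T * R * (spineBack Y k * (R * L) * spineOut Y k) * R * X (Y (k + 1)) * L *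
            X (2 * Z (k + 3)) * (R * spineBack Y (k + 1) * R)) := by
            simp only [spineOut, mul_assoc, mul_neg]
        _ = T * (R * R) * X (Y (k + 1)) * L * X (2 * Z (k + 3)) *
            (R * spineBack Y (k + 1) * R) := by
            rw [R_mul_L]
            simp [spineBack_mul_spineOut, mul_assoc]
        _ = _ := by rw [R_mul_R]; simp only [mul_assoc]

/-- The monodromy around the hole is hyperbolic with eigenvalues `± e^{-P/2}`, `± e^{P/2}` of the
same sign. -/
lemma isLower_prodUpTo {n : ℕ} (hn : 3 ≤ n) (Z Y : ℕ → ℝ) :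
    IsLower (prodUpTo (gammaConj n Z Y) n) (perimeter n Z Y) := by
  obtain ⟨k, rfl⟩ := Nat.exists_eq_add_of_le' hn
  obtain ⟨T, hT, hprod⟩ := exists_prodUpTo_gammaConj (n := k + 3) Z Y k (by omega)
  have e1 : k + 3 - 3 = k := by omega
  have h : prodUpTo (gammaConj (k + 3) Z Y) (k + 3) =
      T * (L * X (2 * Z (k + 3))) * (L * spineBack Y k * R) := by
    rw [prodUpTo, hprod, gammaConj_of_le hn Z Y (by omega), e1]
    calc T * (R * spineBack Y k * R) * -(L * spineOut Y k * R * X (2 * Z (k + 3)) *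
            (L * spineBack Y k * R))
          = -(T * R * (spineBack Y k * (R * L) * spineOut Y k) * R * X (2 * Z (k + 3)) *
            (L * spineBack Y k * R)) := by simp only [mul_assoc, mul_neg]
        _ = T * (R * R) * X (2 * Z (k + 3)) * (L * spineBack Y k * R) := by
            rw [R_mul_L]
            simp [spineBack_mul_spineOut, mul_assoc]
        _ = _ := by rw [R_mul_R]; simp only [mul_assoc]
  rw [h]
  convert (hT.mul (isLower_L_mul_X (2 * Z (k + 3)))).mul (isLower_spineBack Y k) using 1
  rw [perimeter, e1, Finset.sum_Icc_succ_top (by omega)]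
  ring

/-- The first three of the `γ_i` span the traceless matrices. -/
lemma trace_gammaConj_ne_zero {n : ℕ} (hn : 4 ≤ n) (Z Y : ℕ → ℝ) :
    (gammaConj n Z Y 0 * gammaConj n Z Y 1 * gammaConj n Z Y 2).trace ≠ 0 := by
  have h : gammaConj n Z Y 0 * gammaConj n Z Y 1 * gammaConj n Z Y 2 =
      -(L * X (2 * Z 1) * (L * X (2 * Z 2)) * (L * X (Y 1)) * (L * X (2 * Z 3)) *
        (R * X (Y 1))) := by
    rw [gammaConj_zero, gammaConj_of_lt Z Y one_pos (by omega),
      gammaConj_of_lt Z Y two_pos (by omega)]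
    calc _ = L * X (2 * Z 1) * (R * L) * L * X (2 * Z 2) * (R * (R * L) * R) * X (Y 1) * L *
          X (2 * Z 3) * R * X (Y 1) * (L * R) := by
          simp [spineOut, spineBack, mul_assoc]
      _ = _ := by rw [R_mul_L, L_mul_R]; simp [mul_assoc, ← R_mul_R]
  rw [h, Matrix.trace_neg, neg_ne_zero]
  apply ne_of_gt
  simp [L, R, X]
  ring_nf
  positivity

/-! ### Eigenvectors of the monodromy and the Jordan basis -/

/-- The entries which determine a traceless matrix. -/
def coords : Matrix (Fin 2) (Fin 2) ℝ →ₗ[ℝ] (Fin 3 → ℝ) where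
  toFun A := ![A 0 0, A 0 1, A 1 0]
  map_add' A B := by ext i; fin_cases i <;> simp
  map_smul' c A := by ext i; fin_cases i <;> simp

lemma eq_zero_of_coords {A : Matrix (Fin 2) (Fin 2) ℝ} (hA : A.trace = 0) (h : coords A = 0) :
    A = 0 := by
  have h0 : A 0 0 = 0 := congrFun h 0
  have h1 : A 0 1 = 0 := congrFun h 1
  have h2 : A 1 0 = 0 := congrFun h 2
  rw [trace_two] at hA
  ext i j
  fin_cases i <;> fin_cases j <;> simp [h0, h1, h2]
  linarith

/-- The eigenvectors, for the eigenvalues `e^P`, `e^{-P}` and `1`, of conjugation by a lower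
triangular matrix with diagonal `± (e^{-P/2}, e^{P/2})`, `P ≠ 0`, among the traceless matrices. The
third one is the traceless part of the triangular matrix itself; the first two are tensor products
of its left and right eigenvectors. -/
lemma exists_eigenvectors {D : Matrix (Fin 2) (Fin 2) ℝ} {P : ℝ} (hD : IsLower D P) (hP : P ≠ 0) :
    ∃ q : Fin 3 → Matrix (Fin 2) (Fin 2) ℝ, (∀ i, (q i).trace = 0) ∧
      q 0 * D = Real.exp P • (D * q 0) ∧ q 1 * D = Real.exp (-P) • (D * q 1) ∧
      q 2 * D = D * q 2 ∧ (q 2 * q 2).trace ≠ 0 ∧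
      LinearIndependent ℝ (fun i => coords (q i)) := by
  obtain ⟨hu, hdet, hsq⟩ := hD
  set a := D 0 0 with ha
  set d := D 1 1 with hd
  set c := D 1 0 with hc
  have hsq' : d ^ 2 = Real.exp P := by
    have h1 : Real.exp P * Real.exp (-P) = 1 := by rw [← Real.exp_add]; simp
    have h2 : d ^ 2 * Real.exp (-P) = 1 := by
      rw [← hsq]; linear_combination (a * d + 1) * hdet
    exact mul_right_cancel₀ (Real.exp_ne_zero (-P)) (h2.trans h1.symm)
  have had : a - d ≠ 0 := by
    intro h
    rw [sub_eq_zero.1 h, hsq'] at hsq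
    have := Real.exp_injective hsq
    apply hP; linarith
  have hD' : D = !![a, 0; c, d] := by
    ext i j; fin_cases i <;> fin_cases j <;> simp [hu, ha, hc, hd]
  refine ⟨![!![(a - d) * c, -(a - d) ^ 2; c ^ 2, -((a - d) * c)], !![0, 0; 1, 0],
    !![a - d, 0; 2 * c, -(a - d)]], ?_, ?_, ?_, ?_, ?_, ?_⟩
  · intro i; fin_cases i <;> simp
  · rw [hD', ← hsq']
    ext i j
    fin_cases i <;> fin_cases j <;> simp
    · linear_combination (-(d * (a - d) * c)) * hdet
    · linear_combination (-(d * (a - d) ^ 2)) * hdet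
    · linear_combination (-(d * c ^ 2)) * hdet
    · linear_combination (d * (a - d) * c) * hdet
  · rw [hD', ← hsq]
    ext i j
    fin_cases i <;> fin_cases j <;> simp
    linear_combination (-a) * hdet
  · rw [hD']
    ext i j
    fin_cases i <;> fin_cases j <;> simp <;> ring
  · have : 0 < (a - d) * (a - d) := mul_self_pos.2 had
    simp
    intro h
    nlinarith
  · rw [Fintype.linearIndependent_iff]
    intro x hx
    have e0 := congrFun hx 0
    have e1 := congrFun hx 1
    have e2 := congrFun hx 2
    simp [Fin.sum_univ_three, coords, had] at e0 e1 e2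
    have x2 : x 2 = 0 := by simpa [e1, had] using e0
    have x1 : x 1 = 0 := by simpa [e1, x2] using e2
    intro i
    fin_cases i
    exacts [e1, x1, x2]

lemma inv_mul_mul_eq {n : ℕ} {M U J : Matrix (Fin n) (Fin n) ℝ} (hU : IsUnit U.det)
    (h : ∀ j, M *ᵥ U.col j = U *ᵥ J.col j) : U⁻¹ * M * U = J := by
  have h' : M * U = U * J := by
    ext i j
    exact congrFun (h j) i
  rw [mul_assoc, h', Matrix.nonsing_inv_mul_cancel_left _ _ hU]

lemma mulVec_smul_single {n : ℕ} (U : Matrix (Fin n) (Fin n) ℝ) (c : ℝ) (j : Fin n) :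
    U *ᵥ Pi.single j c = c • U.col j := by
  ext i
  simp [mul_comm]

lemma jordanOdd_col {n : ℕ} (P : ℝ) (j : Fin n) :
    (jordanOdd n P).col j = Pi.single j (if (j : ℕ) = 0 then Real.exp P
      else if (j : ℕ) = 1 then Real.exp (-P) else if (j : ℕ) = 2 then 1 else -1) := by
  ext i
  simp only [jordanOdd, Matrix.col_apply, Matrix.diagonal_apply, Pi.single_apply]
  split_ifs <;> simp_all

lemma jordanEven_col {n : ℕ} (P : ℝ) (j : Fin n) (hj : (j : ℕ) ≠ 3) :
    (jordanEven n P).col j = Pi.single j (if (j : ℕ) = 0 then -Real.exp P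
      else if (j : ℕ) = 1 then -Real.exp (-P) else -1) := by
  ext i
  simp only [jordanEven, Matrix.col_apply, Matrix.of_apply, Pi.single_apply]
  split_ifs <;> simp_all

lemma jordanEven_col_three {n : ℕ} (hn : 3 < n) (P : ℝ) :
    (jordanEven n P).col ⟨3, hn⟩ =
      Pi.single ⟨3, hn⟩ (-1) + Pi.single ⟨2, by omega⟩ 1 := by
  ext i
  simp only [jordanEven, Matrix.col_apply, Matrix.of_apply, Pi.single_apply, Pi.add_apply,
    Fin.ext_iff]
  split_ifs <;> simp_all

end AnCase

open AnCase

theorem mainTheorem2 (n : ℕ) (hn : 3 ≤ n) (Z Y : ℕ → ℝ)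
    (hP : AnCase.perimeter n Z Y ≠ 0) :
    (Even n → ∃ U : Matrix (Fin n) (Fin n) ℝ, IsUnit U.det ∧
      U⁻¹ * (((AnCase.stokes n Z Y)ᵀ)⁻¹ * AnCase.stokes n Z Y) * U =
        AnCase.jordanEven n (AnCase.perimeter n Z Y)) ∧
    (Odd n → ∃ U : Matrix (Fin n) (Fin n) ℝ, IsUnit U.det ∧
      U⁻¹ * (((AnCase.stokes n Z Y)ᵀ)⁻¹ * AnCase.stokes n Z Y) * U =
        AnCase.jordanOdd n (AnCase.perimeter n Z Y)) := by
  set P := perimeter n Z Y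
  obtain ⟨q, hq, hq0, hq1, hq2, hq2', hli⟩ := exists_eigenvectors (isLower_prodUpTo hn Z Y) hP
  have htr := gammaConj_trace hn Z Y
  have hsq := gammaConj_sq hn Z Y
  have h4 := fun h : 4 ≤ n => trace_gammaConj_ne_zero h Z Y
  rw [stokes_eq_halfGram]
  set g := gammaConj n Z Y
  set M := ((halfGram n g)ᵀ)⁻¹ * halfGram n g
  have hM : ∀ x, M *ᵥ x = (fun j : Fin n => reflCoeff g (comb n g x) j) - x :=
    inv_mul_halfGram_mulVec htr hsq
  set u : Fin 3 → Fin n → ℝ := fun i j => reflCoeff g (q i) j with hu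
  have hcomb : ∀ i (ν : ℝ), q i * prodUpTo g n = ν • (prodUpTo g n * q i) →
      comb n g (u i) = (1 - (-1) ^ n * ν) • q i := by
    intro i ν h
    rw [hu, comb_reflCoeff htr hsq (hq i), reflOrbit_eq_smul hsq h, sub_smul, one_smul]
  have hMu : ∀ i (ν : ℝ), q i * prodUpTo g n = ν • (prodUpTo g n * q i) →
      M *ᵥ u i = (-((-1) ^ n * ν)) • u i := by
    intro i ν h
    rw [hM, hcomb i ν h]
    ext j
    simp only [hu, reflCoeff_smul, Pi.sub_apply, Pi.smul_apply, smul_eq_mul]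
    ring
  have hq2 : q 2 * prodUpTo g n = (1 : ℝ) • (prodUpTo g n * q 2) := by rw [hq2, one_smul]
  have hker : ∀ x, coords (comb n g x) = 0 → M *ᵥ x = (-1 : ℝ) • x := by
    intro x hx
    rw [hM, eq_zero_of_coords (comb_trace htr x) hx]
    ext j
    simp [reflCoeff_zero]
  have hne1 : Real.exp P ≠ 1 := fun h => hP (Real.exp_eq_one_iff P |>.1 h)
  have hne2 : Real.exp (-P) ≠ 1 := fun h => hP (neg_eq_zero.1 (Real.exp_eq_one_iff (-P) |>.1 h))
  constructor
  · intro heven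
    have hpow : (-1 : ℝ) ^ n = 1 := heven.neg_one_pow
    have hn4 : 4 ≤ n := by
      rcases heven with ⟨m, rfl⟩; omega
    simp only [hpow, one_mul] at hcomb hMu
    obtain ⟨w, hw⟩ := exists_comb_eq htr hn (h4 hn4) (hq 2)
    have hMw : M *ᵥ w = (-1 : ℝ) • w + (1 : ℝ) • u 2 := by
      rw [hM, hw, neg_one_smul, one_smul, sub_eq_add_neg, add_comm]
    -- If `u 2` vanished, every `g j` would be orthogonal to `q 2`, hence `q 2 = ∑ w j • g j` to
    -- itself.
    have hu2 : u 2 ⬝ᵥ u 2 ≠ 0 := by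
      intro h
      have h0 : u 2 = 0 := dotProduct_self_eq_zero.1 h
      have h1 := halfGram_transpose_mulVec htr hsq (hq 2) n
      have h2 : (fun j : Fin n => reflCoeff g (q 2) j) = 0 := h0
      rw [h2, Matrix.mulVec_zero] at h1
      apply hq2'
      nth_rw 1 [← hw]
      rw [comb_apply, Finset.sum_mul, Matrix.trace_sum]
      refine Finset.sum_eq_zero fun j _ => ?_
      have h3 := congrFun h1 j
      simp only [Pi.zero_apply, zero_eq_neg] at h3
      rw [smul_mul_assoc, Matrix.trace_smul, h3, smul_zero]
    have hc0 := hcomb 0 _ hq0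
    have hc1 := hcomb 1 _ hq1
    have hc2 : comb n g (u 2) = 0 := by simpa using hcomb 2 _ hq2
    -- Since `u 2` lies in the kernel of `comb`, pairing with `u 2` is added as a fourth coordinate to
    -- separate it from the other kernel vectors of the basis.
    obtain ⟨U, hU, hUa, hUker⟩ := exists_isUnit_det_of_linearIndependent hn4
      (LinearMap.vecCons (dotProductBilin ℝ ℝ (u 2)) (coords ∘ₗ comb n g))
      ![u 0, u 1, u 2, w] (by
        rw [Fintype.linearIndependent_iff]
        intro x hx
        have hx' : ∑ i, ![x 0 * (1 - Real.exp P), x 1 * (1 - Real.exp (-P)), x 3] i •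
            coords (q i) = 0 := by
          ext r
          have := congrFun hx r.succ
          simpa [Fin.sum_univ_four, Fin.sum_univ_three, hc0, hc1, hc2, hw, mul_assoc] using this
        have hz := Fintype.linearIndependent_iff.1 hli _ hx'
        have x0 : x 0 = 0 := (mul_eq_zero.1 (hz 0)).resolve_right (sub_ne_zero.2 hne1.symm)
        have x1 : x 1 = 0 := (mul_eq_zero.1 (hz 1)).resolve_right (sub_ne_zero.2 hne2.symm)
        have x3 : x 3 = 0 := hz 2
        have x2 : x 2 = 0 := by
          have := congrFun hx 0
          simpa [Fin.sum_univ_four, x0, x1, x3, hu2] using this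
        intro i
        fin_cases i
        exacts [x0, x1, x2, x3])
    refine ⟨U, hU, inv_mul_mul_eq hU fun j => ?_⟩
    have hU0 : U.col ⟨0, by omega⟩ = u 0 := hUa 0
    have hU1 : U.col ⟨1, by omega⟩ = u 1 := hUa 1
    have hU2 : U.col ⟨2, by omega⟩ = u 2 := hUa 2
    have hU3 : U.col ⟨3, by omega⟩ = w := hUa 3
    obtain ⟨j, hj⟩ := j
    match j, hj with
    | 0, hj =>
      rw [jordanEven_col _ _ (by simp), mulVec_smul_single, hU0, hMu 0 _ hq0]; simp; rfl
    | 1, hj =>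
      rw [jordanEven_col _ _ (by simp), mulVec_smul_single, hU1, hMu 1 _ hq1]; simp; rfl
    | 2, hj => rw [jordanEven_col _ _ (by simp), mulVec_smul_single, hU2, hMu 2 _ hq2]; simp
    | 3, hj =>
      rw [jordanEven_col_three, Matrix.mulVec_add, mulVec_smul_single, mulVec_smul_single, hU3,
        hU2, hMw]
    | j + 4, hj =>
      rw [jordanEven_col _ _ (by simp), mulVec_smul_single, hker]
      · simp
      · ext r
        exact congrFun (hUker ⟨j + 4, hj⟩ (by simp)) r.succ
  · intro hodd
    have hpow : (-1 : ℝ) ^ n = -1 := hodd.neg_one_pow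
    simp only [hpow, neg_mul, one_mul, neg_neg, sub_neg_eq_add] at hcomb hMu
    have hc0 := hcomb 0 _ hq0
    have hc1 := hcomb 1 _ hq1
    have hc2 := hcomb 2 _ hq2
    obtain ⟨U, hU, hUa, hUker⟩ := exists_isUnit_det_of_linearIndependent hn
      (coords ∘ₗ comb n g) u (by
        rw [Fintype.linearIndependent_iff]
        intro x hx
        have hx' : ∑ i, ![x 0 * (1 + Real.exp P), x 1 * (1 + Real.exp (-P)),
            x 2 * (1 + 1)] i • coords (q i) = 0 := by
          simpa [Fin.sum_univ_three, hc0, hc1, hc2, mul_smul] using hx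
        have hz := Fintype.linearIndependent_iff.1 hli _ hx'
        have x0 : x 0 = 0 := (mul_eq_zero.1 (hz 0)).resolve_right (by positivity)
        have x1 : x 1 = 0 := (mul_eq_zero.1 (hz 1)).resolve_right (by positivity)
        have x2 : x 2 = 0 := (mul_eq_zero.1 (hz 2)).resolve_right (by positivity)
        intro i
        fin_cases i
        exacts [x0, x1, x2])
    refine ⟨U, hU, inv_mul_mul_eq hU fun j => ?_⟩
    have hU0 : U.col ⟨0, by omega⟩ = u 0 := hUa 0
    have hU1 : U.col ⟨1, by omega⟩ = u 1 := hUa 1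
    have hU2 : U.col ⟨2, by omega⟩ = u 2 := hUa 2
    obtain ⟨j, hj⟩ := j
    rw [jordanOdd_col, mulVec_smul_single]
    match j, hj with
    | 0, hj => rw [hU0, hMu 0 _ hq0]; simp; rfl
    | 1, hj => rw [hU1, hMu 1 _ hq1]; simp; rfl
    | 2, hj => rw [hU2, hMu 2 _ hq2]; simp
    | j + 3, hj =>
      rw [hker]
      · simp
      · exact hUker ⟨j + 3, hj⟩ (by simp)
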